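/- Consider the Adversary Network Creation Game (Adv-NCG) with agent set $V$ and edge-price $\alpha$. A strategy of agent $u$ is a finite multiset $S_u$ over $V\setminus\{u\}$; each occurrence of $v$ in $S_u$ is one undirected edge $uv$ owned by $u$, and the strategies of all agents together form an undirected multigraph $G$ with edge multiset $E$. The cost of agent $u$ is $$\mathrm{cost}_u(G,\alpha)=\alpha\,|S_u|+\frac1{|E|}\sum_{e\in E}\sum_{v\in V}d_{G-e}(u,v),$$ where $d$ is the hop distance ($+\infty$ between disconnected nodes), edges are counted with multiplicity, and $G-e$ is $G$ with one copy of $e$ removed; if $E=\emptyset$, the distance cost is $\sum_{v\in V}d_G(u,v)$. An improving move of $u$ is a change of $S_u$ alone that strictly decreases the cost of $u$. An agent without an improving move plays a best response, a best response move is a strategy change of one agent after which this agent plays a best response, and a network in which all agents play a best response is a pure Nash equilibrium. The game is weakly acyclic if from every network some finite (possibly empty) sequence of improving moves leads to a pure Nash equilibrium. **Theorem.** The Adv-NCG is not weakly acyclic; indeed it is not weakly acyclic for $10$ agents and $\alpha=10.3$. More precisely, for $10$ agents and $\alpha = 10.3$ there are networks $G_1,\dots,G_7$ with $G_7=G_1$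 and $G_1,\dots,G_6$ pairwise distinct that form a best response cycle of length $6$, such that for every $i\in\{1,\dots,6\}$ exactly one agent has an improving move in $G_i$, this improving move is unique, and it leads to $G_{i+1}$. Consequently, every sequence of improving moves starting from $G_1$ is infinite if it is continued as long as possible: after any finite number of improving moves, starting from $G_1$, a further improving move exists. -/

import Mathlib

open scoped NNReal ENNReal

namespace AdvNCG

/-- A network with edge-ownership information, i.e. a vector of pure strategies: the strategy of
agent `u` is a multiset of other agents, and each occurrence of `v` in it is one undirected edge
`uv` that is owned by `u`. -/
@[ext]
structure Network (V : Type*) where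
  strategy : V → Multiset V
  not_mem_self : ∀ u, u ∉ strategy u

variable {V : Type*} [Fintype V] [DecidableEq V]

/-- The edge multiset of the undirected multigraph created by all strategies together. -/
def Network.edges (G : Network V) : Multiset (Sym2 V) :=
  ∑ u : V, (G.strategy u).map fun v => s(u, v)

/-- The sum over all agents `v` of the hop distance from `u` to `v` in the multigraph with edge
multiset `E` (it is infinite if some agent is not reachable from `u`). Parallel edges do not
affect distances, so the distance is that of the simple graph with the same adjacencies. -/
noncomputable def totalDist (E : Multiset (Sym2 V)) (u : V) : ℕ∞ :=
  ∑ v : V, (SimpleGraph.fromEdgeSet {e : Sym2 V | e ∈ E}).edist u v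

/-- Expected distance cost of `u` after one edge, chosen uniformly at random among all edges
counted with multiplicity, has been deleted (only one copy of a parallel edge disappears). If there
is no edge at all, nothing is deleted. -/
noncomputable def expectedDist (E : Multiset (Sym2 V)) (u : V) : ℝ≥0∞ :=
  if E = 0 then (totalDist E u : ℝ≥0∞)
  else (E.map fun e => (totalDist (E.erase e) u : ℝ≥0∞)).sum / (E.card : ℝ≥0∞)

/-- Expected cost of agent `u` in the network `G` for edge-price `α`. -/
noncomputable def cost (α : ℝ≥0) (G : Network V) (u : V) : ℝ≥0∞ :=
  (α : ℝ≥0∞) * ((G.strategy u).card : ℝ≥0∞) + expectedDist G.edges u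

/-- `G'` arises from `G` by a change of the strategy of agent `u` only. -/
def IsMove (u : V) (G G' : Network V) : Prop :=
  G'.strategy u ≠ G.strategy u ∧ ∀ v, v ≠ u → G'.strategy v = G.strategy v

/-- `G'` arises from `G` by an improving move of agent `u`. -/
def IsImprovingMove (α : ℝ≥0) (u : V) (G G' : Network V) : Prop :=
  IsMove u G G' ∧ cost α G' u < cost α G u

/-- Agent `u` has no improving move in `G`. -/
def PlaysBestResponse (α : ℝ≥0) (G : Network V) (u : V) : Prop :=
  ∀ G' : Network V, ¬ IsImprovingMove α u G G'

/-- Pure Nash equilibrium. -/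
def IsNash (α : ℝ≥0) (G : Network V) : Prop :=
  ∀ u : V, PlaysBestResponse α G u

/-- `G'` arises from `G` by a strategy-change of `u` towards a best response. -/
def IsBestResponseMove (α : ℝ≥0) (u : V) (G G' : Network V) : Prop :=
  IsMove u G G' ∧ PlaysBestResponse α G' u

/-- A best response cycle consisting of `k` moves. -/
def IsBestResponseCycle (α : ℝ≥0) {k : ℕ} (G : Fin (k + 1) → Network V) : Prop :=
  G (Fin.last k) = G 0 ∧
    ∀ i : Fin k, ∃ u : V, IsBestResponseMove α u (G i.castSucc) (G i.succ)

/-- One step of the sequential game: some agent performs an improving move. -/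
def Step (α : ℝ≥0) (G G' : Network V) : Prop :=
  ∃ u : V, IsImprovingMove α u G G'

variable (V) in
/-- The game with agent set `V` and edge-price `α` is weakly acyclic: from every network some finite
sequence of improving moves leads to a pure Nash equilibrium. -/
def WeaklyAcyclic (α : ℝ≥0) : Prop :=
  ∀ G : Network V, ∃ G' : Network V, Relation.ReflTransGen (Step α) G G' ∧ IsNash α G'

end AdvNCG

/-! The proof exhibits six networks in a cycle: agent 5 buys and later drops an edge to 2, agent 3
drops and rebuys its edge to 2, and agent 9 swaps an edge between 3 and 5. In each network the only
improving move leads to the next one (`isImprovingMove_cycleNet`, `eq_of_isImprovingMove`). Hence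
the six networks are closed under improving moves and none is an equilibrium.

Uniqueness is a finite computation. Distances from an agent sum to at least 9, so a strategy with
too many edges cannot pay off, whatever its targets; the remaining multisets are enumerated
(`checkAll_sound`). Distances come from breadth-first search on bit masks (`bfs_spec`). Deviations
need only lower bounds on their cost; exact values are needed only for the six networks, so a
million can stand in for infinity. -/

open scoped NNReal ENNReal

namespace AdvNCG

/-! ### Executable distances, costs and strategy search -/

/-- The vertices of `S` (a bit mask) together with both ends of all edges in `l` meeting `S`. -/
def expand (S : ℕ) (l : List ℕ) : ℕ :=
  l.rec S fun e _ r => Nat.lor r (Nat.mul e (Nat.sub 1 (Nat.sub 1 (Nat.land e S))))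

/-- The number of set bits of a number below `2 ^ 10`. -/
def bitCount (x : ℕ) : ℕ :=
  Nat.mod (Nat.land (Nat.mul x 0x200040008001) 0x111111111111111) 15

/-- Breadth-first search from the vertex set `S`: the sum of the distances from `S` to all ten
vertices, or at least a million if some vertex is not reached within `n` rounds. -/
def bfs (l : List ℕ) (n : ℕ) : ℕ → ℕ :=
  n.rec (fun S => Bool.rec 1000000 0 (Nat.beq S 1023)) fun _ r S =>
    Bool.rec (Nat.add (Nat.sub 10 (bitCount S)) (r (expand S l))) 0 (Nat.beq S 1023)

/-- The sum of `f` over all lists arising from `pre ++ post`, up to order, by removing one entry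
of `post`. -/
def sumRemove {β : Type*} (f : List β → ℕ) : List β → List β → ℕ
  | _, [] => 0
  | pre, e :: post => Nat.add (f (pre.reverseAux post)) (sumRemove f (e :: pre) post)

/-- Extension of a check by a further candidate `c`, to be used at most `n` times. -/
def checkWith {β : Type*} (F : ℕ → List β → Bool) (c : β) : ℕ → List β → Bool
  | 0, acc => F 0 acc
  | n + 1, acc => F (n + 1) acc && checkWith F c n (c :: acc)

/-- Checks `test` for all multisets of at most `n` candidates, added to `acc`. -/
def checkAll {β : Type*} (test : List β → Bool) : List β → ℕ → List β → Bool
  | [] => fun _ acc => test acc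
  | c :: cs => checkWith (checkAll test cs) c

/-- The bit mask of the two ends of an edge. -/
def mask (p : Fin 10 × Fin 10) : ℕ := Nat.lor (Nat.pow 2 p.1.1) (Nat.pow 2 p.2.1)

def toEdges (es : List (Fin 10 × Fin 10)) : Multiset (Sym2 (Fin 10)) :=
  (es.map fun p => s(p.1, p.2) : List _)

/-- The edges owned by agents other than `u`. -/
def others (S : Fin 10 → List (Fin 10)) (u : Fin 10) : List (Fin 10 × Fin 10) :=
  (List.finRange 10).flatMap fun w => if w = u then [] else (S w).map (Prod.mk w)

/-- All edges if the others own `H` and `u` plays `T`. -/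
def allEdges (u : Fin 10) (H : List (Fin 10 × Fin 10)) (T : List (Fin 10)) :
    List (Fin 10 × Fin 10) :=
  (T.map (Prod.mk u)).append H

/-- The distance sum of `u` in the network with edge masks `l`. -/
def distSum (u : Fin 10) (l : List ℕ) : ℕ := bfs l 10 (Nat.pow 2 u.1)

/-- The sum of the distance sums over all edge deletions. -/
def removalSum (u : Fin 10) (l : List ℕ) : ℕ := sumRemove (distSum u) [] l

/-- `10 * m` times the cost of an agent who owns `k` of the `m` edges and whose distance sums
over all edge deletions add up to `D`. -/
def scaledCost (k m D : ℕ) : ℕ := Nat.add (Nat.mul 103 (Nat.mul k m)) (Nat.mul 10 D)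

/-- The strategy `T` costs at least `c / (10 * m)` or is one of the exceptions. -/
def testStrategy (u : Fin 10) (H : List (Fin 10 × Fin 10)) (m c : ℕ)
    (exc : List (List (Fin 10))) (T : List (Fin 10)) : Bool :=
  let E := (allEdges u H T).map mask
  Nat.ble c (Nat.mul m (scaledCost T.length 1 (distSum u E))) ||
  Nat.ble (Nat.mul E.length c) (Nat.mul m (scaledCost T.length E.length (removalSum u E))) ||
  exc.any T.isPerm

/-- Only exceptional strategies cost less than `c / (10 * m)`; strategies with more than `n` edges
are too expensive. -/
def testAgent (u : Fin 10) (H : List (Fin 10 × Fin 10)) (m c n : ℕ)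
    (exc : List (List (Fin 10))) : Bool :=
  Nat.ble c (Nat.mul m (scaledCost (n + 1) 1 9)) &&
    checkAll (testStrategy u H m c exc) ((List.finRange 10).filter fun v => v ≠ u) n []

/-! ### Bit masks as vertex sets -/

theorem expand_cons (S e : ℕ) (l : List ℕ) :
    expand S (e :: l) = expand S l ||| e * (1 - (1 - (e &&& S))) := rfl

theorem testBit_mask (p : Fin 10 × Fin 10) (x : ℕ) :
    (mask p).testBit x = true ↔ x = p.1 ∨ x = p.2 := by
  change (2 ^ p.1.1 ||| 2 ^ p.2.1).testBit x = true ↔ _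
  rw [Nat.testBit_or, Bool.or_eq_true, Nat.testBit_two_pow, Nat.testBit_two_pow,
    decide_eq_true_iff, decide_eq_true_iff, eq_comm, @eq_comm ℕ p.2.1]

theorem mask_land_eq_zero_iff (p : Fin 10 × Fin 10) (S : ℕ) :
    mask p &&& S = 0 ↔ ¬ (S.testBit p.1 = true ∨ S.testBit p.2 = true) := by
  constructor
  · rintro h (h1 | h1)
    · have := congrArg (fun n => n.testBit p.1.1) h
      simp [Nat.testBit_and, h1, (testBit_mask p p.1.1).2 (Or.inl rfl)] at this
    · have := congrArg (fun n => n.testBit p.2.1) h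
      simp [Nat.testBit_and, h1, (testBit_mask p p.2.1).2 (Or.inr rfl)] at this
  · intro h
    apply Nat.eq_of_testBit_eq
    intro x
    rw [Nat.testBit_and, Nat.zero_testBit, Bool.and_eq_false_iff]
    by_contra hc
    push Not at hc
    rw [ne_eq, ne_eq, Bool.not_eq_false, Bool.not_eq_false, testBit_mask] at hc
    obtain ⟨rfl | rfl, h2⟩ := hc
    · exact h (Or.inl h2)
    · exact h (Or.inr h2)

/-- Every edge is tested against the original `S`, not the growing result, so one call is exactly
one search round. -/
theorem testBit_expand (S : ℕ) (es : List (Fin 10 × Fin 10)) (x : ℕ) :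
    (expand S (es.map mask)).testBit x = true ↔ S.testBit x = true ∨
      ∃ p ∈ es, (x = p.1 ∨ x = p.2) ∧ (S.testBit p.1 = true ∨ S.testBit p.2 = true) := by
  induction es with
  | nil => simp [expand]
  | cons p es ih =>
    rw [List.map_cons, expand_cons, Nat.testBit_or, Bool.or_eq_true, ih]
    by_cases h : mask p &&& S = 0
    · have h' := (mask_land_eq_zero_iff p S).1 h
      simp [h, h']
    · have h' := not_not.1 (mt (mask_land_eq_zero_iff p S).2 h)
      -- The truncated double subtraction is the 0/1 indicator of a nonempty intersection.
      have : 1 - (1 - (mask p &&& S)) = 1 := by omega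
      rw [this, mul_one, testBit_mask]
      simp only [List.mem_cons, exists_eq_or_imp, h', and_true]
      rw [or_assoc]
      exact or_congr_right or_comm

theorem mask_lt (p : Fin 10 × Fin 10) : mask p < 2 ^ 10 :=
  Nat.or_lt_two_pow (Nat.pow_lt_pow_right (by norm_num) p.1.2)
    (Nat.pow_lt_pow_right (by norm_num) p.2.2)

theorem expand_lt {S : ℕ} (hS : S < 2 ^ 10) (es : List (Fin 10 × Fin 10)) :
    expand S (es.map mask) < 2 ^ 10 := by
  induction es with
  | nil => exact hS
  | cons p es ih =>
    rw [List.map_cons, expand_cons]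
    refine Nat.or_lt_two_pow ih (lt_of_le_of_lt ?_ (mask_lt p))
    calc mask p * (1 - (1 - (mask p &&& S))) ≤ mask p * 1 := Nat.mul_le_mul_left _ (by omega)
      _ = mask p := mul_one _

/-- The multiplier in `bitCount` makes copies shifted by 0, 15, 30 and 45, so each bit lands exactly
once on a position divisible by 4; reduction mod 15 then adds the hexadecimal digits. -/
theorem sum_testBit : ∀ S < 1024,
    (∑ x : Fin 10, if S.testBit x = true then 0 else 1) = 10 - bitCount S := by
  decide +kernel

theorem eq_full_iff : ∀ S < 1024, S = 1023 ↔ ∀ x : Fin 10, S.testBit x = true := by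
  decide +kernel

/-! ### Correctness of breadth-first search -/

variable {V : Type*}

theorem edist_le_succ_iff (G : SimpleGraph V) (u v : V) (k : ℕ) :
    G.edist u v ≤ (k + 1 : ℕ) ↔
      G.edist u v ≤ k ∨ ∃ w, G.Adj w v ∧ G.edist u w ≤ k := by
  constructor
  · intro h
    have hr : G.edist u v ≠ ⊤ := ne_top_of_le_ne_top (ENat.natCast_ne_top _) h
    obtain ⟨p, hp⟩ := SimpleGraph.exists_walk_of_edist_ne_top hr
    rw [← hp] at h
    -- Reversing the walk exposes its last edge to case analysis.
    have hl : p.reverse.length ≤ k + 1 := by rw [SimpleGraph.Walk.length_reverse]; exact_mod_cast h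
    cases hq : p.reverse with
    | nil => left; simp
    | cons hadj q =>
      rw [hq, SimpleGraph.Walk.length_cons] at hl
      right
      refine ⟨_, hadj.symm, (SimpleGraph.edist_le q.reverse).trans ?_⟩
      rw [SimpleGraph.Walk.length_reverse]
      exact_mod_cast (by omega : q.length ≤ k)
  · rintro (h | ⟨w, hw, h⟩)
    · exact h.trans (by exact_mod_cast k.le_succ)
    · calc G.edist u v ≤ G.edist u w + G.edist w v := SimpleGraph.edist_triangle
        _ ≤ k + 1 := add_le_add h (SimpleGraph.edist_eq_one_iff_adj.2 hw).le
        _ = _ := by norm_cast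

/-- A path has fewer edges than there are vertices; hence ten rounds reach everything reachable. -/
theorem edist_le_card_of_ne_top [Fintype V] (G : SimpleGraph V) {u v : V}
    (h : G.edist u v ≠ ⊤) : G.edist u v ≤ Fintype.card V := by
  classical
  obtain ⟨p, hp⟩ := (SimpleGraph.reachable_of_edist_ne_top h).exists_isPath
  exact (SimpleGraph.edist_le p).trans (by exact_mod_cast hp.length_lt.le)

theorem tsub_eq_one_add {a : ℕ∞} {k : ℕ} (h : ¬ a ≤ k) :
    a - k = 1 + (a - (k + 1 : ℕ)) := by
  induction a with
  | top =>
    rw [show (⊤ : ℕ∞) - ((k + 1 : ℕ) : ℕ∞) = ⊤ from ENat.top_sub_natCast _, add_top]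
    exact ENat.top_sub_natCast _
  | coe n =>
    norm_cast at *
    omega

theorem bfs_zero (l : List ℕ) (S : ℕ) : bfs l 0 S = if S = 1023 then 0 else 1000000 := by
  change (Bool.rec 1000000 0 (Nat.beq S 1023) : ℕ) = _
  split_ifs with h
  · subst h; rfl
  · rw [show Nat.beq S 1023 = false from Bool.eq_false_iff.2 (mt Nat.eq_of_beq_eq_true h)]

theorem bfs_succ (l : List ℕ) (n S : ℕ) : bfs l (n + 1) S =
    if S = 1023 then 0 else (10 - bitCount S) + bfs l n (expand S l) := by
  change (Bool.rec (10 - bitCount S + bfs l n (expand S l)) 0 (Nat.beq S 1023) : ℕ) = _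
  split_ifs with h
  · subst h; rfl
  · rw [show Nat.beq S 1023 = false from Bool.eq_false_iff.2 (mt Nat.eq_of_beq_eq_true h)]

def simpleGraph (es : List (Fin 10 × Fin 10)) : SimpleGraph (Fin 10) :=
  SimpleGraph.fromEdgeSet {e | e ∈ toEdges es}

theorem mem_toEdges {es : List (Fin 10 × Fin 10)} {e : Sym2 (Fin 10)} :
    e ∈ toEdges es ↔ ∃ p ∈ es, s(p.1, p.2) = e := by
  simp [toEdges]

theorem testBit_expand_iff_edist_le {es : List (Fin 10 × Fin 10)} {u : Fin 10} {k S : ℕ}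
    (hS : ∀ x : Fin 10, S.testBit x = true ↔ (simpleGraph es).edist u x ≤ k) (x : Fin 10) :
    (expand S (es.map mask)).testBit x = true ↔ (simpleGraph es).edist u x ≤ (k + 1 : ℕ) := by
  rw [testBit_expand, edist_le_succ_iff, hS]
  refine or_congr_right' fun hx => ?_
  constructor
  · rintro ⟨⟨a, b⟩, hp, h1, h2⟩
    rw [hS, hS] at h2
    simp only [← Fin.ext_iff] at h1 h2
    have hab : (simpleGraph es).edist u a ≤ k ∧ x = b ∨ (simpleGraph es).edist u b ≤ k ∧ x = a := by
      rcases h1 with rfl | rfl <;> tauto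
    rcases hab with ⟨h, rfl⟩ | ⟨h, rfl⟩
    · refine ⟨a, ?_, h⟩
      rw [simpleGraph, SimpleGraph.fromEdgeSet_adj]
      exact ⟨mem_toEdges.2 ⟨_, hp, rfl⟩, by rintro rfl; exact hx h⟩
    · refine ⟨b, ?_, h⟩
      rw [simpleGraph, SimpleGraph.fromEdgeSet_adj]
      exact ⟨mem_toEdges.2 ⟨_, hp, Sym2.eq_swap⟩, by rintro rfl; exact hx h⟩
  · rintro ⟨w, hw, h⟩
    rw [simpleGraph, SimpleGraph.fromEdgeSet_adj] at hw
    obtain ⟨p, hp, he⟩ := mem_toEdges.1 hw.1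
    refine ⟨p, hp, ?_⟩
    rw [hS, hS]
    rw [Sym2.eq_iff] at he
    rcases he with ⟨h1, h2⟩ | ⟨h1, h2⟩ <;> simp [h1, h2, h]

/-- Invariant: after `k` rounds `S` is the ball of radius `k` around `u`, and what remains to be
counted is the excess of each distance over `k`. Every vertex outside the ball adds 1 per round. A
result of a million or more is only a lower bound, as the true sum may be infinite. -/
theorem bfs_spec (es : List (Fin 10 × Fin 10)) (u : Fin 10) : ∀ n k S : ℕ, n + k = 10 →
    S < 1024 → (∀ x : Fin 10, S.testBit x = true ↔ (simpleGraph es).edist u x ≤ k) →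
    (bfs (es.map mask) n S : ℕ∞) ≤ ∑ v, ((simpleGraph es).edist u v - k) ∧
    (bfs (es.map mask) n S < 1000000 →
      ∑ v, ((simpleGraph es).edist u v - k) = bfs (es.map mask) n S) := by
  have full : ∀ k S : ℕ, S < 1024 →
      (∀ x : Fin 10, S.testBit x = true ↔ (simpleGraph es).edist u x ≤ k) → S = 1023 →
      ∑ v, ((simpleGraph es).edist u v - k) = 0 := by
    intro k S hS h hf
    refine Finset.sum_eq_zero fun v _ => tsub_eq_zero_of_le ((h v).1 ?_)
    exact (eq_full_iff S hS).1 hf v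
  intro n
  induction n with
  | zero =>
    intro k S hk hS h
    rw [bfs_zero]
    split_ifs with hf
    · simp [full k S hS h hf]
    · refine ⟨?_, fun h => absurd h (lt_irrefl _)⟩
      rw [eq_full_iff S hS] at hf
      push Not at hf
      obtain ⟨x, hx⟩ := hf
      have hx' : (simpleGraph es).edist u x = ⊤ := by
        by_contra hne
        refine hx ((h x).2 ((edist_le_card_of_ne_top _ hne).trans ?_))
        rw [Fintype.card_fin, ← hk, zero_add]
      refine le_trans ?_ (Finset.single_le_sum
        (f := fun v => (simpleGraph es).edist u v - k) (fun _ _ => zero_le) (Finset.mem_univ x))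
      simp [hx']
  | succ n ih =>
    intro k S hk hS h
    rw [bfs_succ]
    split_ifs with hf
    · simp [full k S hS h hf]
    · have hsum : ∑ v, ((simpleGraph es).edist u v - k) = ((10 - bitCount S : ℕ) : ℕ∞) +
          ∑ v, ((simpleGraph es).edist u v - (k + 1 : ℕ)) := by
        have h1 : ∀ v : Fin 10, (simpleGraph es).edist u v - k =
            (if S.testBit v = true then 0 else 1) +
              ((simpleGraph es).edist u v - (k + 1 : ℕ)) := by
          intro v
          split_ifs with hv
          · have hle := (h v).1 hv
            rw [tsub_eq_zero_of_le hle, tsub_eq_zero_of_le (hle.trans _), add_zero]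
            exact_mod_cast k.le_succ
          · exact tsub_eq_one_add (mt (h v).2 hv)
        rw [Finset.sum_congr rfl fun v _ => h1 v, Finset.sum_add_distrib]
        rw [← sum_testBit S hS, Nat.cast_sum]
        refine congrArg₂ _ (Finset.sum_congr rfl fun v _ => ?_) rfl
        by_cases hv : S.testBit v = true
        · rw [if_pos hv, if_pos hv, Nat.cast_zero]
        · rw [if_neg hv, if_neg hv, Nat.cast_one]
      have := ih (k + 1) (expand S (es.map mask)) (by omega) (expand_lt hS es)
        (testBit_expand_iff_edist_le h)
      rw [hsum]
      push_cast at this ⊢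
      refine ⟨add_le_add le_rfl this.1, fun hlt => ?_⟩
      rw [this.2 (by omega)]

theorem distSum_spec (es : List (Fin 10 × Fin 10)) (u : Fin 10) :
    (distSum u (es.map mask) : ℕ∞) ≤ totalDist (toEdges es) u ∧
    (distSum u (es.map mask) < 1000000 →
      totalDist (toEdges es) u = distSum u (es.map mask)) := by
  have := bfs_spec es u 10 0 (2 ^ u.1) rfl (Nat.pow_lt_pow_right (by norm_num) u.2) fun x => by
    rw [Nat.testBit_two_pow]
    simp [Fin.ext_iff]
  simpa [distSum, totalDist, simpleGraph] using this

/-! ### Averaging over edge deletions -/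

theorem toEdges_cons (p : Fin 10 × Fin 10) (es : List (Fin 10 × Fin 10)) :
    toEdges (p :: es) = s(p.1, p.2) ::ₘ toEdges es := rfl

theorem toEdges_append (es es' : List (Fin 10 × Fin 10)) :
    toEdges (es ++ es') = toEdges es + toEdges es' := by
  simp [toEdges]

theorem card_toEdges (es : List (Fin 10 × Fin 10)) : (toEdges es).card = es.length := by
  simp [toEdges]

theorem toEdges_reverseAux (es es' : List (Fin 10 × Fin 10)) :
    toEdges (es.reverseAux es') = toEdges es + toEdges es' := by
  rw [List.reverseAux_eq, toEdges_append]
  congr 1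
  simp [toEdges]

theorem sumRemove_spec (u : Fin 10) (E : Multiset (Sym2 (Fin 10))) :
    ∀ post pre : List (Fin 10 × Fin 10), E = toEdges pre + toEdges post →
    (sumRemove (distSum u) (pre.map mask) (post.map mask) : ℝ≥0∞) ≤
      ((toEdges post).map fun e => (totalDist (E.erase e) u : ℝ≥0∞)).sum ∧
    (sumRemove (distSum u) (pre.map mask) (post.map mask) < 1000000 →
      ((toEdges post).map fun e => (totalDist (E.erase e) u : ℝ≥0∞)).sum =
        sumRemove (distSum u) (pre.map mask) (post.map mask)) := by
  intro post
  induction post with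
  | nil => intro pre _; simp [sumRemove, toEdges]
  | cons p post ih =>
    intro pre hE
    obtain ⟨h1, h2⟩ := ih (p :: pre) (by rw [hE, toEdges_cons, toEdges_cons]; simp)
    have hsum : sumRemove (distSum u) (pre.map mask) ((p :: post).map mask) =
        distSum u ((pre.reverseAux post).map mask) +
          sumRemove (distSum u) ((p :: pre).map mask) (post.map mask) := by
      rw [List.reverseAux_eq, List.map_append, List.map_reverse, ← List.reverseAux_eq]
      rfl
    have herase : E.erase s(p.1, p.2) = toEdges (pre.reverseAux post) := by
      rw [hE, toEdges_cons, toEdges_reverseAux, Multiset.add_cons, Multiset.erase_cons_head]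
    obtain ⟨h3, h4⟩ := distSum_spec (pre.reverseAux post) u
    rw [hsum, toEdges_cons, Multiset.map_cons, Multiset.sum_cons, herase, Nat.cast_add]
    refine ⟨add_le_add ?_ h1, fun hlt => ?_⟩
    · exact_mod_cast ENat.toENNReal_le.2 h3
    -- A total below a million forces both summands below it, so both are exact.
    · rw [h2 (by omega), h4 (by omega)]
      simp

theorem expectedDist_spec (u : Fin 10) {es : List (Fin 10 × Fin 10)} (hes : es ≠ []) :
    (removalSum u (es.map mask) : ℝ≥0∞) / es.length ≤ expectedDist (toEdges es) u ∧
    (removalSum u (es.map mask) < 1000000 →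
      expectedDist (toEdges es) u = (removalSum u (es.map mask) : ℝ≥0∞) / es.length) := by
  have h0 : toEdges es ≠ 0 := by
    rw [ne_eq, ← Multiset.card_eq_zero, card_toEdges]
    simpa using hes
  obtain ⟨h1, h2⟩ := sumRemove_spec u (toEdges es) es [] (by simp [toEdges])
  rw [expectedDist, if_neg h0, card_toEdges]
  exact ⟨ENNReal.div_le_div_right h1 _, fun h => by rw [h2 h]; rfl⟩

theorem totalDist_anti {V : Type*} [Fintype V] {E E' : Multiset (Sym2 V)} (h : E ≤ E') (u : V) :
    totalDist E' u ≤ totalDist E u :=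
  Finset.sum_le_sum fun _ _ => SimpleGraph.edist_anti
    (SimpleGraph.fromEdgeSet_mono fun _ he => Multiset.mem_of_le h he)

/-- Deleting an edge never shortens distances. This gives a cheap bound from a single search, tried
before the search for every deleted edge. -/
theorem totalDist_le_expectedDist {V : Type*} [Fintype V] [DecidableEq V]
    (E : Multiset (Sym2 V)) (u : V) : (totalDist E u : ℝ≥0∞) ≤ expectedDist E u := by
  rw [expectedDist]
  split_ifs with h
  · exact le_rfl
  · have hc : (E.card : ℝ≥0∞) ≠ 0 := by
      rw [Nat.cast_ne_zero, ne_eq, Multiset.card_eq_zero]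
      exact h
    rw [ENNReal.le_div_iff_mul_le (Or.inl hc) (Or.inl (ENNReal.natCast_ne_top _)), mul_comm,
      ← nsmul_eq_mul, ← Multiset.card_map (fun e => (totalDist (E.erase e) u : ℝ≥0∞)) E]
    refine Multiset.card_nsmul_le_sum fun x hx => ?_
    obtain ⟨e, -, rfl⟩ := Multiset.mem_map.1 hx
    exact ENat.toENNReal_le.2 (totalDist_anti (Multiset.erase_le _ _) u)

theorem nine_le_totalDist (E : Multiset (Sym2 (Fin 10))) (u : Fin 10) : 9 ≤ totalDist E u := by
  calc (9 : ℕ∞) = ∑ v : Fin 10, if v ≠ u then 1 else 0 := by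
        rw [← Finset.natCast_card_filter, Finset.filter_ne' Finset.univ u,
          Finset.card_erase_of_mem (Finset.mem_univ u)]
        rfl
    _ ≤ _ := Finset.sum_le_sum fun v _ => by
        split_ifs with h
        · rw [Order.one_le_iff_ne_zero, ne_eq, SimpleGraph.edist_eq_zero_iff]
          exact fun h' => h h'.symm
        · exact zero_le

/-! ### Costs as scaled integers -/

/-- The cost of an agent who owns `k` edges in a network with edge multiset `E`. -/
noncomputable def costAt (E : Multiset (Sym2 (Fin 10))) (u : Fin 10) (k : ℕ) : ℝ≥0∞ :=
  ((103 / 10 : ℝ≥0) : ℝ≥0∞) * k + expectedDist E u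

/-- The cost with scaled value `c` for `m` edges. -/
noncomputable def unscale (m c : ℕ) : ℝ≥0 := c / (10 * m)

/-- The factor `10 * m` clears the denominators of 10.3 and of the average over `m` edges. -/
theorem unscale_scaledCost {m : ℕ} (hm : 0 < m) (k D : ℕ) :
    (unscale m (scaledCost k m D) : ℝ≥0∞) =
      ((103 / 10 : ℝ≥0) : ℝ≥0∞) * k + (D : ℝ≥0∞) / m := by
  have hm' : (m : ℝ≥0) ≠ 0 := by exact_mod_cast hm.ne'
  have h : unscale m (scaledCost k m D) = 103 / 10 * k + D / m := by
    rw [unscale, show scaledCost k m D = 103 * (k * m) + 10 * D from rfl]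
    push_cast
    field_simp
  rw [h, ENNReal.coe_add, ENNReal.coe_mul, ENNReal.coe_div hm']
  simp

theorem unscale_le {m m' c c' : ℕ} (hm : 0 < m) (hm' : 0 < m') (h : m' * c ≤ m * c') :
    unscale m c ≤ unscale m' c' := by
  rw [unscale, unscale, div_le_div_iff₀ (by positivity) (by positivity)]
  have : (m' * c : ℝ≥0) ≤ m * c' := by exact_mod_cast h
  calc (c * (10 * m') : ℝ≥0) = 10 * (m' * c) := by ring
    _ ≤ 10 * (m * c') := by gcongr
    _ = _ := by ring

theorem unscale_lt {m m' c c' : ℕ} (hm : 0 < m) (hm' : 0 < m') (h : m' * c < m * c') :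
    unscale m c < unscale m' c' := by
  rw [unscale, unscale, div_lt_div_iff₀ (by positivity) (by positivity)]
  have : (m' * c : ℝ≥0) < m * c' := by exact_mod_cast h
  calc (c * (10 * m') : ℝ≥0) = 10 * (m' * c) := by ring
    _ < 10 * (m * c') := by gcongr
    _ = _ := by ring

theorem unscale_le_costAt_of_le_totalDist {E : Multiset (Sym2 (Fin 10))} {u : Fin 10}
    {m c k d : ℕ} (hm : 0 < m) (hd : (d : ℕ∞) ≤ totalDist E u)
    (h : c ≤ m * scaledCost k 1 d) : (unscale m c : ℝ≥0∞) ≤ costAt E u k := by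
  refine (ENNReal.coe_le_coe.2 (unscale_le hm one_pos (by rwa [one_mul]))).trans ?_
  rw [unscale_scaledCost one_pos, Nat.cast_one, div_one]
  refine add_le_add le_rfl (le_trans ?_ (totalDist_le_expectedDist E u))
  exact_mod_cast ENat.toENNReal_le.2 hd

/-! ### Soundness of the strategy search -/

theorem checkWith_sound {β : Type*} {F : ℕ → List β → Bool} {c : β} : ∀ {n : ℕ} {acc : List β},
    checkWith F c n acc = true → ∀ j ≤ n, F (n - j) (List.replicate j c ++ acc) = true := by
  intro n
  induction n with
  | zero =>
    intro acc h j hj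
    obtain rfl := Nat.le_zero.1 hj
    exact h
  | succ n ih =>
    intro acc h j hj
    rw [checkWith, Bool.and_eq_true] at h
    cases j with
    | zero => exact h.1
    | succ j =>
      have := ih h.2 j (by omega)
      rw [Nat.add_sub_add_right, List.replicate_succ', List.append_assoc]
      exact this

/-- Split off all copies of the first candidate; the rest uses the later candidates within the
remaining budget. -/
theorem checkAll_sound {β : Type*} [DecidableEq β] {test : List β → Bool} :
    ∀ {cs : List β} {n : ℕ} {acc : List β}, checkAll test cs n acc = true →
      ∀ T : Multiset β, (∀ x ∈ T, x ∈ cs) → T.card ≤ n →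
        ∃ l : List β, (l : Multiset β) = T + acc ∧ test l = true := by
  intro cs
  induction cs with
  | nil =>
    intro n acc h T hT _
    rw [Multiset.eq_zero_of_forall_notMem (fun x hx => List.not_mem_nil (hT x hx)), zero_add]
    exact ⟨acc, rfl, h⟩
  | cons c cs ih =>
    intro n acc h T hT hn
    have hsplit : Multiset.replicate (T.count c) c + T.filter (fun x => ¬ x = c) = T := by
      rw [← Multiset.filter_eq', Multiset.filter_add_not]
    have hcard := congrArg Multiset.card hsplit
    rw [Multiset.card_add, Multiset.card_replicate] at hcard
    obtain ⟨l, hl, ht⟩ := ih (checkWith_sound h (T.count c) (by omega))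
      (T.filter (fun x => ¬ x = c)) (fun x hx => by
        rw [Multiset.mem_filter] at hx
        exact (List.mem_cons.1 (hT x hx.1)).resolve_left hx.2) (by omega)
    refine ⟨l, ?_, ht⟩
    rw [hl, ← Multiset.coe_add, Multiset.coe_replicate, ← add_assoc,
      add_comm (Multiset.filter _ _), hsplit]

theorem toEdges_allEdges (u : Fin 10) (H : List (Fin 10 × Fin 10)) (T : List (Fin 10)) :
    toEdges (allEdges u H T) = (T : Multiset (Fin 10)).map (fun v => s(u, v)) + toEdges H := by
  change toEdges (T.map (Prod.mk u) ++ H) = _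
  rw [toEdges_append]
  congr 1
  simp [toEdges, Function.comp_def]

theorem testStrategy_sound {u : Fin 10} {H : List (Fin 10 × Fin 10)} {m c : ℕ}
    {exc : List (List (Fin 10))} {T : List (Fin 10)} (hH : H ≠ []) (hm : 0 < m)
    (h : testStrategy u H m c exc T = true) :
    (unscale m c : ℝ≥0∞) ≤ costAt (toEdges (allEdges u H T)) u T.length ∨
      ∃ l ∈ exc, (T : Multiset (Fin 10)) = l := by
  have hE : allEdges u H T ≠ [] := by
    change T.map (Prod.mk u) ++ H ≠ []
    simp [hH]
  rw [testStrategy, Bool.or_eq_true, Bool.or_eq_true] at h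
  rcases h with (h | h) | h
  · left
    exact unscale_le_costAt_of_le_totalDist hm (distSum_spec _ u).1 (Nat.le_of_ble_eq_true h)
  · left
    have hm' : 0 < (allEdges u H T).length := List.length_pos_iff.2 hE
    replace h := Nat.le_of_ble_eq_true h
    rw [List.length_map] at h
    refine (ENNReal.coe_le_coe.2 (unscale_le hm hm' h)).trans ?_
    rw [unscale_scaledCost hm']
    exact add_le_add le_rfl (expectedDist_spec u hE).1
  · right
    obtain ⟨l, hl, hp⟩ := List.any_eq_true.1 h
    exact ⟨l, hl, Multiset.coe_eq_coe.2 (List.isPerm_iff.1 hp)⟩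

theorem testAgent_sound {u : Fin 10} {H : List (Fin 10 × Fin 10)} {m c n : ℕ}
    {exc : List (List (Fin 10))} (hH : H ≠ []) (hm : 0 < m)
    (h : testAgent u H m c n exc = true) (T : Multiset (Fin 10)) (hT : u ∉ T) :
    (unscale m c : ℝ≥0∞) ≤ costAt (T.map (fun v => s(u, v)) + toEdges H) u T.card ∨
      ∃ l ∈ exc, T = (l : Multiset (Fin 10)) := by
  rw [testAgent, Bool.and_eq_true] at h
  rcases le_or_gt T.card n with hn | hn
  · obtain ⟨l, hl, ht⟩ := checkAll_sound h.2 T (fun x hx => by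
      rw [List.mem_filter]
      exact ⟨List.mem_finRange x, by simpa using fun hxu : x = u => hT (hxu ▸ hx)⟩) hn
    rw [Multiset.coe_nil, add_zero] at hl
    have := testStrategy_sound hH hm ht
    rwa [toEdges_allEdges, hl, ← Multiset.coe_card, hl] at this
  · left
    -- With at least `n + 1` edges, the edge price plus the minimal distance sum 9 already suffices.
    refine unscale_le_costAt_of_le_totalDist (d := 9) hm (nine_le_totalDist _ _)
      ((Nat.le_of_ble_eq_true h.1).trans (Nat.mul_le_mul_left _ ?_))
    change 103 * ((n + 1) * 1) + 10 * 9 ≤ 103 * (T.card * 1) + 10 * 9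
    omega

theorem toEdges_flatMap {ι : Type*} (f : ι → List (Fin 10 × Fin 10)) (l : List ι) :
    toEdges (l.flatMap f) = (l.map fun i => toEdges (f i)).sum := by
  induction l with
  | nil => rfl
  | cons i l ih => rw [List.flatMap_cons, toEdges_append, ih, List.map_cons, List.sum_cons]

theorem toEdges_others (S : Fin 10 → List (Fin 10)) (u : Fin 10) :
    toEdges (others S u) =
      ∑ w ∈ Finset.univ.erase u, (S w : Multiset (Fin 10)).map fun v => s(w, v) := by
  rw [others, toEdges_flatMap, ← Fin.sum_univ_def, ← Finset.add_sum_erase _ _ (Finset.mem_univ u),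
    if_pos rfl]
  refine (zero_add _).trans (Finset.sum_congr rfl fun w hw => ?_)
  rw [if_neg (Finset.ne_of_mem_erase hw)]
  simp [toEdges, Function.comp_def]

/-- The second summand is unaffected by a deviation of `u`. -/
theorem edges_eq {S : Fin 10 → List (Fin 10)} {u : Fin 10} {G : Network (Fin 10)}
    (h : ∀ w, w ≠ u → G.strategy w = S w) :
    G.edges = (G.strategy u).map (fun v => s(u, v)) + toEdges (others S u) := by
  rw [Network.edges, ← Finset.add_sum_erase _ _ (Finset.mem_univ u), toEdges_others]
  congr 1
  refine Finset.sum_congr rfl fun w hw => ?_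
  rw [h w (Finset.ne_of_mem_erase hw)]

/-! ### The six networks and their verification -/

/-- The strategies in the six networks of the cycle. -/
def strat (i : Fin 6) (v : Fin 10) : List (Fin 10) :=
  match v.1 with
  | 2 => [0, 6, 6]
  | 3 => bif Nat.beq i.1 2 || Nat.beq i.1 3 then [7, 8] else [2, 7, 8]
  | 5 => bif Nat.beq i.1 0 || Nat.beq i.1 5 then [1, 4] else [1, 2, 4]
  | 7 => [1]
  | 8 => [4]
  | 9 => bif Nat.ble i.1 2 then [0, 3] else [0, 5]
  | _ => []

/-- The only agent with an improving move. -/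
def mover (i : Fin 6) : Fin 10 :=
  match i.1 with
  | 0 => 5
  | 1 => 3
  | 2 => 9
  | 3 => 3
  | 4 => 5
  | _ => 9

def curMasks (i : Fin 6) (u : Fin 10) : List ℕ :=
  (allEdges u (others (strat i) u) (strat i u)).map mask

def curScaledCost (i : Fin 6) (u : Fin 10) : ℕ :=
  scaledCost (strat i u).length (curMasks i u).length (removalSum u (curMasks i u))

/-- The current strategy needs no exception: it passes the test with equality. The index `i + 1`
wraps around. -/
def exceptions (i : Fin 6) (u : Fin 10) : List (List (Fin 10)) :=
  if u = mover i then [strat (i + 1) u] else []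

/-- The largest number of edges whose price plus the distance sum 9 does not exceed the current
cost. -/
def sizeBound (i : Fin 6) (u : Fin 10) : ℕ :=
  let m := (curMasks i u).length
  (curScaledCost i u - 90 * m) / (103 * m)

/-- The test that in the `i`-th network agent `u` has no improving move except for the one
leading to the next network. -/
def agentTested (i : Fin 6) (u : Fin 10) : Bool :=
  testAgent u (others (strat i) u) (curMasks i u).length (curScaledCost i u) (sizeBound i u)
    (exceptions i u)

theorem agents_tested_zero : ∀ u, agentTested 0 u = true := by decide +kernel

theorem agents_tested_one : ∀ u, agentTested 1 u = true := by decide +kernel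

theorem agents_tested_two : ∀ u, agentTested 2 u = true := by decide +kernel

theorem agents_tested_three : ∀ u, agentTested 3 u = true := by decide +kernel

theorem agents_tested_four : ∀ u, agentTested 4 u = true := by decide +kernel

theorem agents_tested_five : ∀ u, agentTested 5 u = true := by decide +kernel

theorem agents_tested (i : Fin 6) (u : Fin 10) : agentTested i u = true := by
  fin_cases i
  exacts [agents_tested_zero u, agents_tested_one u, agents_tested_two u, agents_tested_three u,
    agents_tested_four u, agents_tested_five u]

theorem removalSum_lt : ∀ i u, removalSum u (curMasks i u) < 1000000 := by decide +kernel

theorem others_ne_nil : ∀ i u, others (strat i) u ≠ [] := by decide +kernel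

theorem mover_ne_mover_succ : ∀ i, mover (i + 1) ≠ mover i := by decide +kernel

theorem strat_succ_of_ne_mover : ∀ i u, u ≠ mover i → strat (i + 1) u = strat i u := by
  decide +kernel

/-- Cross-multiplied, because a move may change the number of edges. -/
theorem scaledCost_mover_lt : ∀ i, (curMasks i (mover i)).length *
    curScaledCost (i + 1) (mover i) <
      (curMasks (i + 1) (mover i)).length * curScaledCost i (mover i) := by
  decide +kernel

/-- The networks of the cycle. -/
def cycleNet (i : Fin 6) : Network (Fin 10) where
  strategy u := strat i u
  not_mem_self := by
    have : ∀ i u, u ∉ strat i u := by decide +kernel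
    exact fun u => this i u

theorem cycleNet_injective : Function.Injective cycleNet := by
  have : ∀ i j, (∀ u, (strat i u : Multiset (Fin 10)) = strat j u) → i = j := by decide +kernel
  exact fun i j h => this i j fun u => congrFun (congrArg Network.strategy h) u

theorem length_curMasks_pos (i : Fin 6) (u : Fin 10) : 0 < (curMasks i u).length := by
  have := List.length_pos_iff.2 (others_ne_nil i u)
  rw [curMasks, List.length_map]
  change 0 < ((strat i u).map (Prod.mk u) ++ others (strat i) u).length
  rw [List.length_append]
  omega

theorem cost_eq_costAt (G : Network (Fin 10)) (u : Fin 10) :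
    cost (103 / 10) G u = costAt G.edges u (G.strategy u).card := rfl

theorem cost_cycleNet (i : Fin 6) (u : Fin 10) :
    cost (103 / 10) (cycleNet i) u =
      (unscale (curMasks i u).length (curScaledCost i u) : ℝ≥0∞) := by
  have hne : allEdges u (others (strat i) u) (strat i u) ≠ [] := by
    have := length_curMasks_pos i u
    rw [curMasks, List.length_map] at this
    exact List.length_pos_iff.1 this
  have hE : (cycleNet i).edges = toEdges (allEdges u (others (strat i) u) (strat i u)) := by
    rw [toEdges_allEdges]
    exact edges_eq fun _ _ => rfl
  rw [cost_eq_costAt, curScaledCost, unscale_scaledCost (length_curMasks_pos i u), costAt, hE,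
    (expectedDist_spec u hne).2 (removalSum_lt i u), curMasks, List.length_map]
  rfl

theorem isImprovingMove_cycleNet (i : Fin 6) :
    IsImprovingMove (103 / 10) (mover i) (cycleNet i) (cycleNet (i + 1)) := by
  have hlt : cost (103 / 10) (cycleNet (i + 1)) (mover i) <
      cost (103 / 10) (cycleNet i) (mover i) := by
    rw [cost_cycleNet, cost_cycleNet]
    exact ENNReal.coe_lt_coe.2 (unscale_lt (length_curMasks_pos _ _) (length_curMasks_pos _ _)
      (scaledCost_mover_lt i))
  have hoff : ∀ v, v ≠ mover i → (cycleNet (i + 1)).strategy v = (cycleNet i).strategy v :=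
    fun v hv => congrArg _ (strat_succ_of_ne_mover i v hv)
  -- An unchanged strategy would make the networks equal, against the strict drop in cost.
  refine ⟨⟨fun h => hlt.ne ?_, hoff⟩, hlt⟩
  have : cycleNet (i + 1) = cycleNet i := by
    ext1
    funext v
    by_cases hv : v = mover i
    · rw [hv, h]
    · exact hoff v hv
  rw [this]

theorem eq_of_isImprovingMove {i : Fin 6} {v : Fin 10} {G : Network (Fin 10)}
    (h : IsImprovingMove (103 / 10) v (cycleNet i) G) :
    v = mover i ∧ G = cycleNet (i + 1) := by
  obtain ⟨⟨-, hoff⟩, hlt⟩ := h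
  have hE := edges_eq (S := strat i) (u := v) (G := G) hoff
  rw [cost_cycleNet, cost_eq_costAt, hE] at hlt
  rcases testAgent_sound (others_ne_nil i v) (length_curMasks_pos i v) (agents_tested i v)
    (G.strategy v) (G.not_mem_self v) with h' | ⟨l, hl, hG⟩
  · exact absurd h' hlt.not_ge
  · rw [exceptions] at hl
    split_ifs at hl with hv
    · obtain rfl := List.mem_singleton.1 hl
      refine ⟨hv, ?_⟩
      ext1
      funext w
      by_cases hw : w = v
      · rw [hw, hG]
        rfl
      · rw [hoff w hw]
        exact congrArg _ (strat_succ_of_ne_mover i w (hv ▸ hw)).symm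
    · exact absurd hl List.not_mem_nil

/-- After the move, only a different agent can improve. -/
theorem playsBestResponse_cycleNet (i : Fin 6) :
    PlaysBestResponse (103 / 10) (cycleNet (i + 1)) (mover i) :=
  fun _ h => mover_ne_mover_succ i (eq_of_isImprovingMove h).1.symm

theorem mem_range_of_step {G G' : Network (Fin 10)} (h : G ∈ Set.range cycleNet)
    (hs : Step (103 / 10) G G') : G' ∈ Set.range cycleNet := by
  obtain ⟨i, rfl⟩ := h
  obtain ⟨v, hv⟩ := hs
  exact ⟨i + 1, (eq_of_isImprovingMove hv).2.symm⟩

end AdvNCG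

/-! ### Assembling the cycle -/

open AdvNCG

theorem mainTheorem5 :
    ¬ AdvNCG.WeaklyAcyclic (Fin 10) (103 / 10) ∧
    ∃ G : Fin 7 → AdvNCG.Network (Fin 10),
      AdvNCG.IsBestResponseCycle (103 / 10) G ∧
      Function.Injective (fun i : Fin 6 => G i.castSucc) ∧
      (∀ i : Fin 6, ∃ u : Fin 10,
        AdvNCG.IsImprovingMove (103 / 10) u (G i.castSucc) (G i.succ) ∧
        ∀ (v : Fin 10) (G' : AdvNCG.Network (Fin 10)),
          AdvNCG.IsImprovingMove (103 / 10) v (G i.castSucc) G' → v = u ∧ G' = G i.succ) ∧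
      (∀ (k : ℕ) (H : ℕ → AdvNCG.Network (Fin 10)), H 0 = G 0 →
        (∀ j < k, AdvNCG.Step (103 / 10) (H j) (H (j + 1))) →
        ∃ G' : AdvNCG.Network (Fin 10), AdvNCG.Step (103 / 10) (H k) G') := by
  -- The seven indices are reduced mod 6, which closes the cycle by definition.
  have hcast : ∀ i : Fin 6, Fin.ofNat 6 i.castSucc.1 = i := by decide
  have hsucc : ∀ i : Fin 6, Fin.ofNat 6 i.succ.1 = i + 1 := by decide
  refine ⟨fun h => ?_, fun i => cycleNet (Fin.ofNat 6 i.1), ⟨rfl, fun i => ⟨mover i, ?_⟩⟩, ?_,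
    fun i => ⟨mover i, ?_⟩, fun k H h0 hstep => ?_⟩
  · obtain ⟨G', hreach, hnash⟩ := h (cycleNet 0)
    have hmem : G' ∈ Set.range cycleNet := by
      clear hnash
      induction hreach with
      | refl => exact ⟨0, rfl⟩
      | tail _ hs ih => exact mem_range_of_step ih hs
    obtain ⟨i, rfl⟩ := hmem
    exact hnash (mover i) _ (isImprovingMove_cycleNet i)
  · beta_reduce
    rw [hcast, hsucc]
    exact ⟨(isImprovingMove_cycleNet i).1, playsBestResponse_cycleNet i⟩
  · intro i j hij
    simp only [hcast] at hij
    exact cycleNet_injective hij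
  · beta_reduce
    rw [hcast, hsucc]
    exact ⟨isImprovingMove_cycleNet i, fun v G' h => eq_of_isImprovingMove h⟩
  · have hmem : ∀ j ≤ k, H j ∈ Set.range cycleNet := by
      intro j
      induction j with
      | zero => exact fun _ => ⟨0, h0.symm⟩
      | succ j ih => exact fun hj => mem_range_of_step (ih (by omega)) (hstep j hj)
    obtain ⟨i, hi⟩ := hmem k le_rfl
    exact ⟨cycleNet (i + 1), mover i, hi ▸ isImprovingMove_cycleNet i⟩
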